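/- Let $0\le p\le 1$ and $n\ge 1$. Let $T_{n,p}$ be the random graph on $[n]=\{1,\dots,n\}$ obtained by starting with vertex $1$ and adding the vertices $2,\dots,n$ one by one, where each new vertex is, independently, dominating (joined to all previous vertices) with probability $p$ and isolated (joined to none of them) with probability $1-p$. Let $\widehat T_{n,p}$ be obtained from $T_{n,p}$ by a uniformly random permutation of the vertex labels, independent of $T_{n,p}$. For $0<p<1$ let $\mu_p$ be the probability distribution on $[0,1]$ with density $(1-p)/p$ on $(0,p)$ and $p/(1-p)$ on $(p,1)$; let $\mu_0$ and $\mu_1$ be the point masses at $0$ and at $1$. Put $$S_p=\bigl\{(x,y)\in[0,1]^2 : x\ge \mu_p\bigl([0,1-y)\bigr)\bigr\}.$$ For a symmetric measurable $S\subseteq[0,1]^2$ let $T_{n,S}$ be the random graph on $[n]$ in which distinct $i,j$ are joined if and only if $(U_i,U_j)\in S$, where $U_1,\dots,U_n$ are independent and uniform on $(0,1)$. For a real random variable $X$ and $t\in\mathbb R$ let $T_{n;X,t}$ be the random graph on $[n]$ in which distinct $i,j$ are joined if and only if $X_i+X_j>t$, where $X_1,\dots,X_n$ are independent copies of $X$.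 Then: 1. $S_p$ is the closed quadrilateral with successive vertices $(0,1)$, $(1-p,1-p)$, $(1,0)$, $(1,1)$, that is, the union of the triangle with vertices $(0,1),(1-p,1-p),(1,1)$ and the triangle with vertices $(1,0),(1-p,1-p),(1,1)$ (degenerate for $p=0$); 2. $\widehat T_{n,p}\overset{d}{=}T_{n,S_p}$; 3. $\widehat T_{n,p}\overset{d}{=}T_{n;X,0}$, where $X$ has density $1-p$ on $(-1,0)$ and $p$ on $(0,1)$. -/

import Mathlib

open MeasureTheory ProbabilityTheory
open scoped ENNReal unitInterval

noncomputable section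

namespace RandomThreshold

/-- Every set of permutations of the finite set `Fin n` is an event. -/
instance instMeasurableSpacePermFin (n : ℕ) : MeasurableSpace (Equiv.Perm (Fin n)) := ⊤

/-! ### Sequential addition of isolated or dominating vertices -/

/-- The graph obtained by adding the vertices of `Fin n` one by one in their natural order, where
vertex `j` is dominating (joined to all previous vertices) if `b j = true`, and isolated (joined to
no previous vertex) if `b j = false`. The value of `b` at the first vertex is irrelevant. -/
def sequentialGraph {n : ℕ} (b : Fin n → Bool) : SimpleGraph (Fin n) :=
  SimpleGraph.fromRel fun i j => i < j ∧ b j = true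

/-- The law of `n` independent choices, each equal to `true` with probability `p` and
to `false` with probability `1 - p`. -/
def choicesLaw (n : ℕ) (p : I) : Measure (Fin n → Bool) :=
  Measure.pi fun _ => Ber(true, false, p)

/-- The uniform distribution on the permutations of `Fin n`. -/
def uniformPermLaw (n : ℕ) : Measure (Equiv.Perm (Fin n)) :=
  (PMF.uniformOfFintype (Equiv.Perm (Fin n))).toMeasure

/-- The law of the randomly permuted sequential graph: the sequential graph with independent
choices, its vertices relabelled by an independent uniformly random permutation. -/
def permutedSequentialLaw (n : ℕ) (p : I) : Measure (SimpleGraph (Fin n)) :=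
  ((uniformPermLaw n).prod (choicesLaw n p)).map
    fun ω => (sequentialGraph ω.2).map ω.1

/-! ### Random graphs from symmetric increasing sets -/

/-- The graph on `Fin n` with an edge between distinct `i`, `j` when `(u i, u j) ∈ S`
(for symmetric `S` the order of `i` and `j` does not matter). -/
def setGraph {n : ℕ} (S : Set (ℝ × ℝ)) (u : Fin n → ℝ) : SimpleGraph (Fin n) :=
  SimpleGraph.fromRel fun i j => (u i, u j) ∈ S

/-- The law of `setGraph S (U₁, …, Uₙ)` with `U₁, …, Uₙ` independent and uniform on `(0,1)`. -/
def setGraphLaw (n : ℕ) (S : Set (ℝ × ℝ)) : Measure (SimpleGraph (Fin n)) :=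
  (Measure.pi fun _ : Fin n => (volume : Measure ℝ).restrict (Set.Ioo 0 1)).map (setGraph S)

/-- For a probability distribution `μ` on `[0,1]` with distribution function `F`, the closed
increasing set of all `(x, y) ∈ [0,1]²` with `x ≥ F((1 - y)-) = μ [0, 1 - y)`. -/
def increasingSet (μ : Measure ℝ) : Set (ℝ × ℝ) :=
  {z | z.1 ∈ Set.Icc (0 : ℝ) 1 ∧ z.2 ∈ Set.Icc (0 : ℝ) 1 ∧ μ.real (Set.Ico 0 (1 - z.2)) ≤ z.1}

/-- The distribution with density `(1-p)/p` on `(0,p)` and `p/(1-p)` on `(p,1)` when `0 < p < 1`,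
the point mass at `0` when `p = 0`, and the point mass at `1` when `p = 1`. -/
def limitDegreeLaw (p : ℝ) : Measure ℝ :=
  if p = 0 then Measure.dirac 0
  else if p = 1 then Measure.dirac 1
  else volume.withDensity fun x =>
    (Set.Ioo 0 p).indicator (fun _ => ENNReal.ofReal ((1 - p) / p)) x +
      (Set.Ioo p 1).indicator (fun _ => ENNReal.ofReal (p / (1 - p))) x

/-- The set `S_p`. -/
def thresholdSet (p : ℝ) : Set (ℝ × ℝ) := increasingSet (limitDegreeLaw p)

/-- The closed quadrilateral with successive vertices `(0,1)`, `(1-p,1-p)`, `(1,0)`, `(1,1)`,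
as the union of the two triangles into which its diagonal from `(1-p,1-p)` to `(1,1)` divides it.
(It is not convex when `p < 1/2`, and for `p = 0` it degenerates to the two edges at `(1,1)`.) -/
def quadrilateral (p : ℝ) : Set (ℝ × ℝ) :=
  convexHull ℝ {(0, 1), (1 - p, 1 - p), (1, 1)} ∪ convexHull ℝ {(1, 0), (1 - p, 1 - p), (1, 1)}

/-! ### Random weights -/

/-- The graph on `Fin n` with an edge between distinct `i`, `j` when `x i + x j > t`. -/
def weightsGraph {n : ℕ} (t : ℝ) (x : Fin n → ℝ) : SimpleGraph (Fin n) :=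
  SimpleGraph.fromRel fun i j => x i + x j > t

/-- The law of the random-weights graph with threshold `t` and independent weights with
common distribution `ν`. -/
def weightsGraphLaw (n : ℕ) (ν : Measure ℝ) (t : ℝ) : Measure (SimpleGraph (Fin n)) :=
  (Measure.pi fun _ : Fin n => ν).map (weightsGraph t)

/-- The weight distribution with density `1 - p` on `(-1,0)` and `p` on `(0,1)`. -/
def weightLaw (p : ℝ) : Measure ℝ :=
  volume.withDensity fun x =>
    (Set.Ioo (-1) 0).indicator (fun _ => ENNReal.ofReal (1 - p)) x +
      (Set.Ioo 0 1).indicator (fun _ => ENNReal.ofReal p) x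

end RandomThreshold

end

noncomputable section

namespace RandomThreshold

/-! ### The set `S_p` -/

/-! All three random graphs are functions of one sample. Give each vertex an independent sign,
positive with probability `p`, and an independent magnitude uniform on `(0,1)`, and join two
vertices when the one of larger magnitude is positive (`rankedGraph`).

Listing the vertices by increasing magnitude turns this into the sequential graph: the order is a
uniform permutation, and it is independent of the signs read along it (`map_rankedGraph`).

The signed magnitude has law `weightLaw p`, and a sum of two of them has the sign of the larger
magnitude (`signedWeight_add_pos_iff`). Applying the distribution function of this law yields a
uniform variable (`map_unitCoordinate`), and the same edge rule becomes membership in `S_p`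
(`unitCoordinate_mem_thresholdSet_iff`). Ties have probability zero, so closed and strict
inequalities define almost surely the same graph.

Both the graph comparison and the quadrilateral use the symmetric inequality for `S_p` in
`mem_thresholdSet_iff`. -/

theorem withDensity_two_indicators (s t : Set ℝ) (hs : MeasurableSet s) (ht : MeasurableSet t)
    (a b : ℝ≥0∞) :
    (volume.withDensity fun x => s.indicator (fun _ => a) x + t.indicator (fun _ => b) x) =
      a • volume.restrict s + b • volume.restrict t := by
  have h := withDensity_add_left (μ := (volume : Measure ℝ))
    (f := s.indicator fun _ => a) (measurable_const.indicator hs) (t.indicator fun _ => b)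
  rw [withDensity_indicator hs, withDensity_indicator ht, withDensity_const,
    withDensity_const] at h
  exact h

theorem limitDegreeLaw_real_Ico {p s : ℝ} (hp0 : 0 < p) (hp1 : p < 1) (hs0 : 0 ≤ s)
    (hs1 : s ≤ 1) :
    (limitDegreeLaw p).real (Set.Ico 0 s) =
      (1 - p) / p * min s p + p / (1 - p) * max (s - p) 0 := by
  have h1 : Set.Ico 0 s ∩ Set.Ioo 0 p = Set.Ioo 0 (min s p) := by
    ext x; simp only [Set.mem_inter_iff, Set.mem_Ico, Set.mem_Ioo, lt_min_iff]; grind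
  have h2 : Set.Ico 0 s ∩ Set.Ioo p 1 = Set.Ioo p s := by
    ext x; simp only [Set.mem_inter_iff, Set.mem_Ico, Set.mem_Ioo]; grind
  have ha : 0 ≤ (1 - p) / p := div_nonneg (by linarith) hp0.le
  have hb : 0 ≤ p / (1 - p) := div_nonneg hp0.le (by linarith)
  have hm : 0 ≤ min s p := le_min hs0 hp0.le
  rw [limitDegreeLaw, if_neg hp0.ne', if_neg hp1.ne,
    withDensity_two_indicators _ _ measurableSet_Ioo measurableSet_Ioo]
  simp only [Measure.real, Measure.add_apply, Measure.smul_apply, smul_eq_mul,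
    Measure.restrict_apply measurableSet_Ico, h1, h2, Real.volume_Ioo, sub_zero]
  rw [← ENNReal.ofReal_mul ha, ← ENNReal.ofReal_mul hb, ENNReal.toReal_add (by simp) (by simp),
    ENNReal.toReal_ofReal (mul_nonneg ha hm), ENNReal.ofReal_mul hb, ENNReal.toReal_mul,
    ENNReal.toReal_ofReal hb, ENNReal.toReal_ofReal']

/-- For `0 < p < 1` the boundary is `p x = (1-p)(1-y)` where `y ≥ 1-p` and `(1-p)(1-x) = p y` where
`y ≤ 1-p`. These lines are mirror images in the diagonal and meet at `(1-p, 1-p)`, hence the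
`max`/`min` form, which also covers `p = 0` and `p = 1`. -/
theorem mem_thresholdSet_iff (p : I) (x y : ℝ) :
    (x, y) ∈ thresholdSet p ↔ x ∈ Set.Icc (0 : ℝ) 1 ∧ y ∈ Set.Icc (0 : ℝ) 1 ∧
      (1 - (p : ℝ)) * (1 - max x y) ≤ p * min x y := by
  obtain ⟨p, hp0, hp1⟩ := p
  simp only [thresholdSet, increasingSet, Set.mem_ofPred_eq]
  refine and_congr_right fun hx => and_congr_right fun hy => ?_
  obtain ⟨hx0, hx1⟩ := hx
  obtain ⟨hy0, hy1⟩ := hy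
  rcases hp0.eq_or_lt with rfl | hp0
  · rw [limitDegreeLaw, if_pos rfl, Measure.real, Measure.dirac_apply' _ measurableSet_Ico]
    by_cases h : y < 1
    · rw [Set.indicator_of_mem (by simpa using h)]
      simp only [Pi.one_apply, ENNReal.toReal_one]
      grind
    · rw [Set.indicator_of_notMem (by simpa using h)]
      simp only [ENNReal.toReal_zero]
      grind
  rcases hp1.eq_or_lt with rfl | hp1
  · rw [limitDegreeLaw, if_neg one_ne_zero, if_pos rfl, Measure.real,
      Measure.dirac_apply' _ measurableSet_Ico, Set.indicator_of_notMem (by simp [hy0]), ENNReal.toReal_zero]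
    grind
  rw [limitDegreeLaw_real_Ico hp0 hp1 (by linarith) (by linarith)]
  have hq : 0 < 1 - p := by linarith
  rcases le_total (1 - p) y with h | h
  · rw [min_eq_left (by linarith : 1 - y ≤ p), max_eq_right (by linarith : 1 - y - p ≤ 0), mul_zero,
      add_zero, div_mul_eq_mul_div, div_le_iff₀ hp0]
    rcases le_total x y with h' | h'
    · rw [max_eq_right h', min_eq_left h', mul_comm p x]
    · rw [max_eq_left h', min_eq_right h']
      -- Here `1 - p ≤ y ≤ x`, so both inequalities hold.
      constructor <;> intro _ <;> nlinarith
  · rw [min_eq_right (by linarith : p ≤ 1 - y), max_eq_left (by linarith : 0 ≤ 1 - y - p),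
      div_mul_cancel₀ _ hp0.ne', div_mul_eq_mul_div, ← le_sub_iff_add_le', div_le_iff₀ hq]
    rcases le_total x y with h' | h'
    · rw [max_eq_right h', min_eq_left h']
      -- Here `x ≤ y ≤ 1 - p`, so either inequality forces `x = y = 1 - p`.
      constructor <;> intro _ <;> nlinarith
    · rw [max_eq_left h', min_eq_right h']
      constructor <;> intro _ <;> nlinarith

theorem convexHull_upper_triangle (p : I) :
    convexHull ℝ {((0 : ℝ), (1 : ℝ)), (1 - (p : ℝ), 1 - (p : ℝ)), (1, 1)} =
      {z : ℝ × ℝ | 0 ≤ z.1 ∧ z.1 ≤ z.2 ∧ z.2 ≤ 1 ∧ (1 - (p : ℝ)) * (1 - z.2) ≤ p * z.1} := by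
  obtain ⟨p, hp0, hp1⟩ := p
  apply Set.Subset.antisymm
  · apply convexHull_min
    · rintro z (rfl | rfl | rfl) <;> refine ⟨?_, ?_, ?_, ?_⟩ <;> dsimp only <;> nlinarith
    · rintro ⟨x, y⟩ ⟨h1, h2, h3, h4⟩ ⟨x', y'⟩ ⟨h1', h2', h3', h4'⟩ a b ha hb hab
      dsimp only at h1 h2 h3 h4 h1' h2' h3' h4'
      obtain rfl : b = 1 - a := by linarith
      refine ⟨?_, ?_, ?_, ?_⟩ <;> simp only [Prod.smul_mk, Prod.mk_add_mk, smul_eq_mul]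
      · positivity
      · nlinarith
      · nlinarith
      · nlinarith [mul_le_mul_of_nonneg_left h4 ha, mul_le_mul_of_nonneg_left h4' hb]
  · rintro ⟨x, y⟩ ⟨h1, h2, h3, h4⟩
    dsimp only at h1 h2 h3 h4
    -- Barycentric coordinates: `y - x` at `(0,1)`, `b` at `(1-p,1-p)`, the rest at `(1,1)`. Both
    -- coordinate equations amount to `p * b = 1 - y`. For `p = 0` the last two vertices coincide
    -- and `b = 0` serves.
    have key : ∀ b : ℝ, 0 ≤ b → p * b = 1 - y → b ≤ 1 - (y - x) →
        (x, y) ∈ convexHull ℝ {((0 : ℝ), (1 : ℝ)), (1 - p, 1 - p), (1, 1)} := by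
      intro b hb hpb hb1
      refine mem_convexHull_of_exists_fintype ![y - x, b, 1 - (y - x) - b]
        ![(0, 1), (1 - p, 1 - p), (1, 1)] ?_ ?_ ?_ ?_
      · intro i
        fin_cases i <;> simp <;> linarith
      · simp [Fin.sum_univ_three]
      · intro i
        fin_cases i <;> simp
      · simp only [Fin.sum_univ_three, Matrix.cons_val]
        ext <;> simp <;> linarith
    rcases hp0.eq_or_lt with rfl | hp0
    · exact key 0 le_rfl (by linarith) (by linarith)
    · refine key ((1 - y) / p) (div_nonneg (by linarith) hp0.le) (by field_simp) ?_
      rw [div_le_iff₀ hp0]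
      linarith

theorem thresholdSet_eq_quadrilateral (p : I) : thresholdSet p = quadrilateral p := by
  have hswap : ({((1 : ℝ), (0 : ℝ)), (1 - (p : ℝ), 1 - (p : ℝ)), (1, 1)} : Set (ℝ × ℝ)) =
      Prod.swap '' {((0 : ℝ), (1 : ℝ)), (1 - (p : ℝ), 1 - (p : ℝ)), (1, 1)} := by
    simp [Set.image_insert_eq]
  have hlin : IsLinearMap ℝ (Prod.swap : ℝ × ℝ → ℝ × ℝ) := ⟨fun _ _ => rfl, fun _ _ => rfl⟩
  rw [quadrilateral, hswap, ← hlin.image_convexHull, convexHull_upper_triangle]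
  ext ⟨x, y⟩
  rw [mem_thresholdSet_iff, Set.image_swap_eq_preimage_swap]
  simp only [Set.mem_union, Set.mem_preimage, Prod.swap_prod_mk, Set.mem_ofPred_eq, Set.mem_Icc]
  rcases le_total x y with h | h
  · rw [max_eq_right h, min_eq_left h]
    constructor
    · rintro ⟨h1, h2, h3⟩
      exact Or.inl ⟨h1.1, h, h2.2, h3⟩
    · rintro (⟨h1, h2, h3, h4⟩ | ⟨h1, h2, h3, h4⟩)
      · exact ⟨⟨h1, by linarith⟩, ⟨by linarith, h3⟩, h4⟩
      · obtain rfl : x = y := le_antisymm h h2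
        exact ⟨⟨h1, h3⟩, ⟨h1, h3⟩, h4⟩
  · rw [max_eq_left h, min_eq_right h]
    constructor
    · rintro ⟨h1, h2, h3⟩
      exact Or.inr ⟨h2.1, h, h1.2, h3⟩
    · rintro (⟨h1, h2, h3, h4⟩ | ⟨h1, h2, h3, h4⟩)
      · obtain rfl : x = y := le_antisymm h2 h
        exact ⟨⟨h1, h3⟩, ⟨h1, h3⟩, h4⟩
      · exact ⟨⟨by linarith, h3⟩, ⟨h1, by linarith⟩, h4⟩

/-! ### Sorting independent uniform variables -/

/-- The graph on `Fin n` in which `i` and `j` with `r i < r j` are joined if `b j = true`. -/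
def rankedGraph {n : ℕ} (b : Fin n → Bool) (r : Fin n → ℝ) : SimpleGraph (Fin n) :=
  SimpleGraph.fromRel fun i j => r i < r j ∧ b j = true

/-- The uniform distribution on `(0,1)`. -/
abbrev unifLaw : Measure ℝ := (volume : Measure ℝ).restrict (Set.Ioo 0 1)

instance : IsProbabilityMeasure unifLaw := ⟨by simp [unifLaw]⟩

instance (n : ℕ) : DiscreteMeasurableSpace (Equiv.Perm (Fin n)) := ⟨fun _ => trivial⟩

instance (n : ℕ) : IsProbabilityMeasure (uniformPermLaw n) := by
  unfold uniformPermLaw; infer_instance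

instance (n : ℕ) (p : I) : IsProbabilityMeasure (choicesLaw n p) := by
  unfold choicesLaw; infer_instance

theorem rankedGraph_eq_map {n : ℕ} (b : Fin n → Bool) (r : Fin n → ℝ)
    (e : Equiv.Perm (Fin n)) (h : StrictMono (r ∘ e)) :
    rankedGraph b r = (sequentialGraph (b ∘ e)).map e := by
  ext u v
  obtain ⟨i, rfl⟩ := e.surjective u
  obtain ⟨j, rfl⟩ := e.surjective v
  have hlt : ∀ i j, r (e i) < r (e j) ↔ i < j := fun i j => h.lt_iff_lt
  rw [show (⇑e : Fin n → Fin n) = e.toEmbedding from rfl, SimpleGraph.map_adj_apply]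
  simp [rankedGraph, sequentialGraph, hlt]

theorem measurePreserving_comp_perm {n : ℕ} {α : Type*} [MeasurableSpace α] (μ : Measure α)
    [SigmaFinite μ] (e : Equiv.Perm (Fin n)) :
    MeasurePreserving (fun f : Fin n → α => f ∘ e) (Measure.pi fun _ => μ)
      (Measure.pi fun _ => μ) := by
  have h := measurePreserving_piCongrLeft (α := fun _ : Fin n => α) (fun _ => μ) e.symm
  have heq : (MeasurableEquiv.piCongrLeft (fun _ : Fin n => α) e.symm : (Fin n → α) → Fin n → α) =
      fun f => f ∘ e := by
    ext f j
    obtain ⟨i, rfl⟩ := e.symm.surjective j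
    simp [MeasurableEquiv.coe_piCongrLeft, Equiv.piCongrLeft_apply_apply]
  rwa [heq] at h

theorem ae_injective_pi_unifLaw (n : ℕ) :
    ∀ᵐ r ∂(Measure.pi fun _ : Fin n => unifLaw), Function.Injective r := by
  have h : ∀ i j : Fin n, ∀ᵐ r ∂(Measure.pi fun _ : Fin n => unifLaw), i ≠ j → r i ≠ r j := by
    intro i j
    by_cases hij : i = j
    · simp [hij]
    have hind : IndepFun (fun r : Fin n → ℝ => r i) (fun r => r j)
        (Measure.pi fun _ : Fin n => unifLaw) :=
      (iIndepFun_pi (μ := fun _ : Fin n => unifLaw) (X := fun _ x => x)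
        fun _ => aemeasurable_id).indepFun hij
    have hmap := (indepFun_iff_map_prod_eq_prod_map_map (measurable_pi_apply i).aemeasurable
      (measurable_pi_apply j).aemeasurable).1 hind
    rw [(measurePreserving_eval (fun _ : Fin n => unifLaw) i).map_eq,
      (measurePreserving_eval (fun _ : Fin n => unifLaw) j).map_eq] at hmap
    have hprod : ∀ᵐ z ∂(unifLaw.prod unifLaw), z.1 ≠ z.2 := by
      rw [Measure.ae_prod_iff_ae_ae (p := fun z : ℝ × ℝ => z.1 ≠ z.2)
        (measurableSet_eq_fun measurable_fst measurable_snd).compl]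
      refine Filter.Eventually.of_forall fun x => ?_
      filter_upwards [(measure_eq_zero_iff_ae_notMem).1 (measure_singleton (μ := unifLaw) x)]
        with y hy h
      exact hy h.symm
    rw [← hmap] at hprod
    have := ae_of_ae_map (by fun_prop) hprod
    filter_upwards [this] with r hr _ using hr
  filter_upwards [ae_all_iff.2 fun i => ae_all_iff.2 (h i)] with r hr i j hij
  by_contra hne
  exact hr i j hne hij

theorem measurable_sort (n : ℕ) : Measurable (Tuple.sort : (Fin n → ℝ) → Equiv.Perm (Fin n)) := by
  refine measurable_to_countable' fun e => ?_
  have : Tuple.sort ⁻¹' {e} = {r : Fin n → ℝ | (∀ i j, i ≤ j → r (e i) ≤ r (e j)) ∧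
      ∀ i j, i < j → r (e i) = r (e j) → e i < e j} := by
    ext r
    rw [Set.mem_preimage, Set.mem_singleton_iff, eq_comm, Tuple.eq_sort_iff]
    rfl
  rw [this]
  measurability

theorem sort_eq_iff_strictMono {n : ℕ} {r : Fin n → ℝ} (hr : Function.Injective r)
    (e : Equiv.Perm (Fin n)) : Tuple.sort r = e ↔ StrictMono (r ∘ e) := by
  rw [eq_comm, Tuple.eq_sort_iff]
  exact ⟨fun h => h.1.strictMono_of_injective (hr.comp e.injective),
    fun h => ⟨h.monotone, fun i j hij he => absurd (h hij) he.not_lt⟩⟩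

/-- By exchangeability each permutation is the sorting one with the same probability, up to ties,
and these probabilities sum to one. -/
theorem measurePreserving_sort (n : ℕ) :
    MeasurePreserving Tuple.sort (Measure.pi fun _ : Fin n => unifLaw) (uniformPermLaw n) := by
  refine ⟨measurable_sort n, ?_⟩
  set P := Measure.pi fun _ : Fin n => unifLaw
  have hconst : ∀ e, P.map Tuple.sort {e} = P {r | StrictMono r} := by
    intro e
    have hm : MeasurableSet {r : Fin n → ℝ | StrictMono r} := by
      simp only [StrictMono]
      measurability
    rw [Measure.map_apply (measurable_sort n) (measurableSet_singleton e),
      ← (measurePreserving_comp_perm unifLaw e).measure_preimage hm.nullMeasurableSet]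
    refine measure_congr ?_
    filter_upwards [ae_injective_pi_unifLaw n] with r hr
    exact propext (sort_eq_iff_strictMono hr e)
  have : IsProbabilityMeasure (P.map Tuple.sort) :=
    Measure.isProbabilityMeasure_map (measurable_sort n).aemeasurable
  have htot := measure_univ (μ := P.map Tuple.sort)
  rw [← Finset.coe_univ, ← sum_measure_singleton] at htot
  simp only [hconst, Finset.sum_const, nsmul_eq_mul, Finset.card_univ] at htot
  refine Measure.ext_of_singleton fun e => ?_
  rw [hconst, uniformPermLaw, PMF.toMeasure_apply_singleton _ _ (measurableSet_singleton e),
    PMF.uniformOfFintype_apply]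
  exact ENNReal.eq_inv_of_mul_eq_one_left (by rwa [mul_comm])

theorem map_rankedGraph (n : ℕ) (p : I) :
    ((choicesLaw n p).prod (Measure.pi fun _ : Fin n => unifLaw)).map
      (fun ω => rankedGraph ω.1 ω.2) = permutedSequentialLaw n p := by
  have h1 := (measurePreserving_sort n).prod (MeasurePreserving.id (choicesLaw n p))
  -- The signs are reindexed by the random permutation itself. For each fixed permutation this
  -- preserves their law, so they stay independent of it.
  have h2 : MeasurePreserving (fun ω : Equiv.Perm (Fin n) × (Fin n → Bool) => (ω.1, ω.2 ∘ ω.1))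
      ((uniformPermLaw n).prod (choicesLaw n p)) ((uniformPermLaw n).prod (choicesLaw n p)) :=
    (MeasurePreserving.id _).skew_product (μc := choicesLaw n p)
      (g := fun (e : Equiv.Perm (Fin n)) (b : Fin n → Bool) => b ∘ e) .of_discrete
      (Filter.Eventually.of_forall fun e => (measurePreserving_comp_perm _ e).map_eq)
  have h3 := (h2.comp h1).comp (Measure.measurePreserving_swap (μ := choicesLaw n p)
    (ν := Measure.pi fun _ : Fin n => unifLaw))
  rw [permutedSequentialLaw, ← h3.map_eq, Measure.map_map .of_discrete h3.measurable]
  refine Measure.map_congr ?_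
  have hr := Measure.quasiMeasurePreserving_snd (μ := choicesLaw n p)
    (ν := Measure.pi fun _ : Fin n => unifLaw) |>.ae (ae_injective_pi_unifLaw n)
  filter_upwards [hr] with ω hω
  exact rankedGraph_eq_map _ _ _ ((sort_eq_iff_strictMono hω _).1 rfl)

/-! ### Signed magnitudes -/

theorem map_unifLaw_affine (a d : ℝ) (ha : a ≠ 0) (s : Set ℝ) (hs : MeasurableSet s)
    (h : (fun x => a * x + d) ⁻¹' s = Set.Ioo 0 1) :
    unifLaw.map (fun x => a * x + d) = ENNReal.ofReal |a⁻¹| • volume.restrict s := by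
  have hmap : (volume : Measure ℝ).map (fun x => a * x + d) = ENNReal.ofReal |a⁻¹| • volume := by
    have : (fun x => a * x + d) = (fun x => x + d) ∘ (fun x => a * x) := rfl
    rw [this, ← Measure.map_map (by fun_prop) (by fun_prop), Real.map_volume_mul_left ha,
      Measure.map_smul, (measurePreserving_add_right volume d).map_eq]
  rw [unifLaw, ← h, ← Measure.restrict_map (by fun_prop) hs, hmap, Measure.restrict_smul]

/-- The factor `c` cancels the Jacobian. In this form `c = 0` is allowed, both sides being zero, so
degenerate `p` needs no separate treatment. -/
theorem smul_map_unifLaw_affine {c : ℝ} (hc : 0 ≤ c) (d : ℝ) :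
    ENNReal.ofReal c • unifLaw.map (fun x => c * x + d) =
      volume.restrict (Set.Ioo d (d + c)) := by
  rcases hc.eq_or_lt with rfl | hc
  · simp
  rw [map_unifLaw_affine c d hc.ne' (Set.Ioo d (d + c)) measurableSet_Ioo, smul_smul,
    ← ENNReal.ofReal_mul hc.le, abs_of_pos (inv_pos.2 hc), mul_inv_cancel₀ hc.ne',
    ENNReal.ofReal_one, one_smul]
  ext x
  simp only [Set.mem_preimage, Set.mem_Ioo]
  constructor <;> rintro ⟨h1, h2⟩ <;> constructor <;> nlinarith

theorem smul_map_unifLaw_reflect {c : ℝ} (hc : 0 ≤ c) :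
    ENNReal.ofReal c • unifLaw.map (fun x => c * (1 - x)) = volume.restrict (Set.Ioo 0 c) := by
  rcases hc.eq_or_lt with rfl | hc
  · simp
  rw [show (fun x : ℝ => c * (1 - x)) = fun x => -c * x + c by ext; ring,
    map_unifLaw_affine (-c) c (neg_ne_zero.2 hc.ne') (Set.Ioo 0 c) measurableSet_Ioo, smul_smul,
    ← ENNReal.ofReal_mul hc.le, inv_neg, abs_neg, abs_of_pos (inv_pos.2 hc),
    mul_inv_cancel₀ hc.ne', ENNReal.ofReal_one, one_smul]
  ext x
  simp only [Set.mem_preimage, Set.mem_Ioo]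
  constructor <;> rintro ⟨h1, h2⟩ <;> constructor <;> nlinarith

theorem map_bernoulli_prod (p : I) (f : Bool × ℝ → ℝ) (hf : Measurable f) :
    ((Ber(true, false, p)).prod unifLaw).map f =
      ENNReal.ofReal p • unifLaw.map (fun x => f (true, x)) +
        ENNReal.ofReal (1 - p) • unifLaw.map (fun x => f (false, x)) := by
  have h1 : Measurable (Prod.mk true : ℝ → Bool × ℝ) := measurable_prodMk_left
  have h2 : Measurable (Prod.mk false : ℝ → Bool × ℝ) := measurable_prodMk_left
  have hp : (unitInterval.toNNReal p : ℝ≥0∞) = ENNReal.ofReal p := by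
    rw [ENNReal.ofReal, ENNReal.coe_inj]; ext; simp [p.2.1]
  have hq : (unitInterval.toNNReal (unitInterval.symm p) : ℝ≥0∞) = ENNReal.ofReal (1 - p) := by
    rw [ENNReal.ofReal, ENNReal.coe_inj]; ext; simp [p.2.2]
  rw [bernoulliMeasure_def, Measure.add_prod, Measure.prod_smul_left, Measure.prod_smul_left,
    Measure.dirac_prod, Measure.dirac_prod, Measure.map_add _ _ hf, Measure.map_smul,
    Measure.map_smul, Measure.map_map hf h1, Measure.map_map hf h2, ← hp, ← hq]
  rfl

/-- The weight with magnitude `z.2` and sign given by `z.1`. -/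
def signedWeight (z : Bool × ℝ) : ℝ := if z.1 then z.2 else -z.2

/-- The point of `(0,1)` corresponding to the weight with magnitude `z.2` and sign given
by `z.1`. -/
def unitCoordinate (p : ℝ) (z : Bool × ℝ) : ℝ :=
  if z.1 then p * z.2 + (1 - p) else (1 - p) * (1 - z.2)

theorem measurable_signedWeight : Measurable signedWeight :=
  Measurable.ite (measurable_fst (measurableSet_singleton true)) measurable_snd measurable_snd.neg

theorem measurable_unitCoordinate (p : ℝ) : Measurable (unitCoordinate p) :=
  Measurable.ite (measurable_fst (measurableSet_singleton true)) (by fun_prop) (by fun_prop)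

theorem map_signedWeight (p : I) :
    ((Ber(true, false, p)).prod unifLaw).map signedWeight = weightLaw p := by
  rw [map_bernoulli_prod p _ measurable_signedWeight, weightLaw,
    withDensity_two_indicators _ _ measurableSet_Ioo measurableSet_Ioo, add_comm]
  have hneg := map_unifLaw_affine (-1) 0 (by norm_num) (Set.Ioo (-1) 0) measurableSet_Ioo
    (by ext x; simp)
  simp only [inv_neg, inv_one, abs_neg, abs_one, ENNReal.ofReal_one, one_smul, neg_mul, one_mul,
    add_zero] at hneg
  simp [signedWeight, hneg, Measure.map_id']

/-- Negative signs fill `(0, 1-p)` with mass `1-p` and positive signs fill `(1-p, 1)` with mass `p`,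
so the total density is one. -/
theorem map_unitCoordinate (p : I) :
    ((Ber(true, false, p)).prod unifLaw).map (unitCoordinate p) = unifLaw := by
  obtain ⟨hp0, hp1⟩ := p.2
  rw [map_bernoulli_prod p _ (measurable_unitCoordinate p)]
  have h1 := smul_map_unifLaw_affine hp0 (1 - p)
  have h2 := smul_map_unifLaw_reflect (sub_nonneg.2 hp1)
  simp only [unitCoordinate, if_true, Bool.false_eq_true, if_false]
  -- Half-open intervals absorb the missing null point `1 - p`.
  rw [h1, h2, sub_add_cancel, add_comm, restrict_Ioo_eq_restrict_Ioc, restrict_Ioo_eq_restrict_Ioc,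
    unifLaw, restrict_Ioo_eq_restrict_Ioc,
    ← Measure.restrict_union (Set.Ioc_disjoint_Ioc_of_le le_rfl) measurableSet_Ioc,
    Set.Ioc_union_Ioc_eq_Ioc (by linarith) (by linarith)]

/-- The joint law of independent signs and magnitudes. -/
abbrev signedLaw (n : ℕ) (p : I) : Measure (Fin n → Bool × ℝ) :=
  Measure.pi fun _ => (Ber(true, false, p)).prod unifLaw

/-! ### Measurability of the graph maps. -/

theorem measurable_fromRel {n : ℕ} {Ω : Type*} [MeasurableSpace Ω] (R : Ω → Fin n → Fin n → Prop)
    (hR : ∀ i j, MeasurableSet {ω | R ω i j}) :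
    Measurable fun ω => SimpleGraph.fromRel (R ω) := by
  refine SimpleGraph.measurable_iff_adj.2 fun i j => ?_
  simp only [SimpleGraph.fromRel_adj]
  exact measurable_const.and ((measurableSet_setOfPred.1 (hR i j)).or (measurableSet_setOfPred.1 (hR j i)))

theorem measurableSet_thresholdSet (p : I) : MeasurableSet (thresholdSet p) := by
  have : thresholdSet p = {z : ℝ × ℝ | z.1 ∈ Set.Icc (0 : ℝ) 1} ∩
      ({z : ℝ × ℝ | z.2 ∈ Set.Icc (0 : ℝ) 1} ∩
        {z : ℝ × ℝ | (1 - (p : ℝ)) * (1 - max z.1 z.2) ≤ p * min z.1 z.2}) := by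
    ext ⟨x, y⟩
    exact mem_thresholdSet_iff p x y
  rw [this]
  exact (measurable_fst measurableSet_Icc).inter ((measurable_snd measurableSet_Icc).inter
    (measurableSet_le (by fun_prop) (by fun_prop)))

theorem measurable_setGraph (n : ℕ) (S : Set (ℝ × ℝ)) (hS : MeasurableSet S) :
    Measurable (setGraph S : (Fin n → ℝ) → SimpleGraph (Fin n)) :=
  measurable_fromRel _ fun i j =>
    ((measurable_pi_apply i).prodMk (measurable_pi_apply j)) hS

theorem measurable_weightsGraph (n : ℕ) (t : ℝ) :
    Measurable (weightsGraph t : (Fin n → ℝ) → SimpleGraph (Fin n)) :=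
  measurable_fromRel _ fun i j => measurableSet_lt (by fun_prop) (by fun_prop)

theorem measurable_rankedGraph (n : ℕ) :
    Measurable fun ω : (Fin n → Bool) × (Fin n → ℝ) => rankedGraph ω.1 ω.2 :=
  measurable_fromRel _ fun i j => by
    have h1 : MeasurableSet {ω : (Fin n → Bool) × (Fin n → ℝ) | ω.2 i < ω.2 j} :=
      measurableSet_lt (by fun_prop) (by fun_prop)
    have h2 : MeasurableSet {ω : (Fin n → Bool) × (Fin n → ℝ) | ω.1 j = true} :=
      measurableSet_eq_fun ((measurable_pi_apply j).comp measurable_fst) measurable_const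
    exact h1.inter h2

/-! ### The common sample and its almost sure properties. -/

theorem map_signedLaw_rankedGraph (n : ℕ) (p : I) :
    (signedLaw n p).map (fun z => rankedGraph (fun i => (z i).1) (fun i => (z i).2)) =
      permutedSequentialLaw n p := by
  have h := measurePreserving_arrowProdEquivProdArrow Bool ℝ (Fin n)
    (fun _ => Ber(true, false, p)) (fun _ => unifLaw)
  rw [← map_rankedGraph, choicesLaw, ← h.map_eq,
    Measure.map_map (measurable_rankedGraph n) h.measurable]
  rfl

/-- For `p = 0` or `p = 1`, `unitCoordinate` collapses one sign to a point and loses the magnitudes;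
almost surely that sign does not occur. -/
theorem ae_bernoulli_nondegenerate (p : I) :
    ∀ᵐ b ∂Ber(true, false, p), (b = true → (0 : ℝ) < p) ∧ (b = false → (p : ℝ) < 1) := by
  rcases p.2.1.eq_or_lt with hp | hp
  · have hp' : p = 0 := Subtype.ext hp.symm
    rw [hp', bernoulliMeasure_def]
    simp
  rcases p.2.2.eq_or_lt with hp1 | hp1
  · have hp' : p = 1 := Subtype.ext hp1
    rw [hp', bernoulliMeasure_def]
    simp
  exact Filter.Eventually.of_forall fun _ => ⟨fun _ => hp, fun _ => hp1⟩

theorem ae_signedLaw (n : ℕ) (p : I) :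
    ∀ᵐ z ∂signedLaw n p, Function.Injective (fun i => (z i).2) ∧
      (∀ i, (z i).2 ∈ Set.Ioo (0 : ℝ) 1) ∧
      ∀ i, ((z i).1 = true → (0 : ℝ) < p) ∧ ((z i).1 = false → (p : ℝ) < 1) := by
  have heval := fun i => (measurePreserving_eval
    (fun _ : Fin n => (Ber(true, false, p)).prod unifLaw) i).quasiMeasurePreserving
  refine Filter.Eventually.and ?_ (Filter.Eventually.and ?_ ?_)
  · have h := measurePreserving_arrowProdEquivProdArrow Bool ℝ (Fin n)
      (fun _ => Ber(true, false, p)) (fun _ => unifLaw)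
    exact (Measure.quasiMeasurePreserving_snd.comp h.quasiMeasurePreserving).ae
      (ae_injective_pi_unifLaw n)
  · exact ae_all_iff.2 fun i => (Measure.quasiMeasurePreserving_snd.comp (heval i)).ae
      (ae_restrict_mem measurableSet_Ioo)
  · exact ae_all_iff.2 fun i => (Measure.quasiMeasurePreserving_fst.comp (heval i)).ae
      (ae_bernoulli_nondegenerate p)

theorem signedWeight_add_pos_iff {z w : Bool × ℝ} (hz : 0 < z.2) (hw : 0 < w.2)
    (hne : z.2 ≠ w.2) :
    0 < signedWeight z + signedWeight w ↔
      (z.2 < w.2 ∧ w.1 = true) ∨ (w.2 < z.2 ∧ z.1 = true) := by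
  obtain ⟨_ | _, x⟩ := z <;> obtain ⟨_ | _, y⟩ := w <;> simp [signedWeight] at * <;> grind

theorem unitCoordinate_mem_Icc (p : I) {z : Bool × ℝ} (hz : z.2 ∈ Set.Ioo (0 : ℝ) 1) :
    unitCoordinate p z ∈ Set.Icc (0 : ℝ) 1 := by
  obtain ⟨p, hp0, hp1⟩ := p
  obtain ⟨_ | _, x⟩ := z <;> obtain ⟨h0, h1⟩ := hz <;> simp [unitCoordinate] at * <;>
    constructor <;> nlinarith

/-- Two negative signs put both coordinates below `1 - p`, outside the set; two positive signs put
both at or above `1 - p`, inside it. For mixed signs the inequality compares the magnitudes after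
division by `p * (1 - p)`. -/
theorem unitCoordinate_mem_thresholdSet_iff (p : I) {z w : Bool × ℝ} (hz : z.2 ∈ Set.Ioo (0 : ℝ) 1)
    (hw : w.2 ∈ Set.Ioo (0 : ℝ) 1) (hne : z.2 ≠ w.2)
    (hzp : (z.1 = true → (0 : ℝ) < p) ∧ (z.1 = false → (p : ℝ) < 1))
    (hwp : (w.1 = true → (0 : ℝ) < p) ∧ (w.1 = false → (p : ℝ) < 1)) :
    (unitCoordinate p z, unitCoordinate p w) ∈ thresholdSet p ↔
      (z.2 < w.2 ∧ w.1 = true) ∨ (w.2 < z.2 ∧ z.1 = true) := by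
  rw [mem_thresholdSet_iff, and_iff_right (unitCoordinate_mem_Icc p hz),
    and_iff_right (unitCoordinate_mem_Icc p hw)]
  obtain ⟨p, hp0, hp1⟩ := p
  have mixed : ∀ x y : ℝ, 0 < x → x < 1 → 0 < y → y < 1 → x ≠ y → 0 < p → p < 1 →
      ((1 - p) * (1 - max (p * x + (1 - p)) ((1 - p) * (1 - y))) ≤
        p * min (p * x + (1 - p)) ((1 - p) * (1 - y)) ↔ y < x) := by
    intro x y hx0 hx1 hy0 hy1 hxy hp0 hp1
    have hle : (1 - p) * (1 - y) ≤ p * x + (1 - p) := by nlinarith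
    rw [max_eq_left hle, min_eq_right hle]
    have hpq : 0 < p * (1 - p) := mul_pos hp0 (by linarith)
    have : (1 - p) * (1 - (p * x + (1 - p))) ≤ p * ((1 - p) * (1 - y)) ↔
        p * (1 - p) * y ≤ p * (1 - p) * x := by constructor <;> intro _ <;> linarith
    rw [this, mul_le_mul_iff_right₀ hpq]
    exact ⟨fun h => lt_of_le_of_ne h hxy.symm, le_of_lt⟩
  obtain ⟨b, x⟩ := z
  obtain ⟨c, y⟩ := w
  obtain ⟨hx0, hx1⟩ := hz
  obtain ⟨hy0, hy1⟩ := hw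
  dsimp only at hne hx0 hx1 hy0 hy1 hzp hwp
  rcases b with _ | _ <;> rcases c with _ | _ <;>
    simp only [unitCoordinate, if_true, if_false, Bool.false_eq_true, and_false, or_false,
      false_or, and_true, iff_false, not_le]
  · have hp1 := hzp.2 rfl
    have hmax : max ((1 - p) * (1 - x)) ((1 - p) * (1 - y)) < 1 - p :=
      max_lt (by nlinarith) (by nlinarith)
    have hmin := (min_le_max (a := (1 - p) * (1 - x)) (b := (1 - p) * (1 - y))).trans_lt hmax
    nlinarith
  · rw [max_comm, min_comm]
    exact mixed y x hy0 hy1 hx0 hx1 hne.symm (hwp.1 rfl) (hzp.2 rfl)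
  · exact mixed x y hx0 hx1 hy0 hy1 hne (hzp.1 rfl) (hwp.2 rfl)
  · refine iff_of_true ?_ (lt_or_gt_of_ne hne)
    have hmin : 1 - p ≤ min (p * x + (1 - p)) (p * y + (1 - p)) :=
      le_min (by nlinarith) (by nlinarith)
    have hmax := hmin.trans (min_le_max (a := p * x + (1 - p)) (b := p * y + (1 - p)))
    nlinarith

/-! ### The two identities in law. -/

theorem setGraphLaw_thresholdSet (n : ℕ) (p : I) :
    setGraphLaw n (thresholdSet p) = permutedSequentialLaw n p := by
  have hpi := Measure.pi_map_pi (μ := fun _ : Fin n => (Ber(true, false, p)).prod unifLaw)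
    (f := fun _ => unitCoordinate p)
    (hμ := fun _ => by rw [map_unitCoordinate]; infer_instance)
    fun _ => (measurable_unitCoordinate p).aemeasurable
  simp only [map_unitCoordinate] at hpi
  have hm : Measurable fun (z : Fin n → Bool × ℝ) i => unitCoordinate p (z i) :=
    measurable_pi_lambda _ fun i => (measurable_unitCoordinate p).comp (measurable_pi_apply i)
  rw [setGraphLaw, ← hpi, Measure.map_map
    (measurable_setGraph n _ (measurableSet_thresholdSet p)) hm, ← map_signedLaw_rankedGraph]
  refine Measure.map_congr ?_
  filter_upwards [ae_signedLaw n p] with z hz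
  obtain ⟨hinj, hmem, hdeg⟩ := hz
  ext i j
  simp only [Function.comp_apply, setGraph, rankedGraph, SimpleGraph.fromRel_adj]
  refine and_congr_right fun hij => ?_
  rw [unitCoordinate_mem_thresholdSet_iff p (hmem i) (hmem j) (hinj.ne hij) (hdeg i) (hdeg j),
    unitCoordinate_mem_thresholdSet_iff p (hmem j) (hmem i) (hinj.ne hij.symm) (hdeg j) (hdeg i)]
  tauto

theorem weightsGraphLaw_weightLaw (n : ℕ) (p : I) :
    weightsGraphLaw n (weightLaw p) 0 = permutedSequentialLaw n p := by
  have hpi := Measure.pi_map_pi (μ := fun _ : Fin n => (Ber(true, false, p)).prod unifLaw)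
    (f := fun _ => signedWeight)
    (hμ := fun _ => by
      have := Measure.isProbabilityMeasure_map (μ := (Ber(true, false, p)).prod unifLaw)
        measurable_signedWeight.aemeasurable
      infer_instance)
    fun _ => measurable_signedWeight.aemeasurable
  simp only [map_signedWeight] at hpi
  have hm : Measurable fun (z : Fin n → Bool × ℝ) i => signedWeight (z i) :=
    measurable_pi_lambda _ fun i => measurable_signedWeight.comp (measurable_pi_apply i)
  rw [weightsGraphLaw, ← hpi, Measure.map_map (measurable_weightsGraph n 0) hm,
    ← map_signedLaw_rankedGraph]
  refine Measure.map_congr ?_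
  filter_upwards [ae_signedLaw n p] with z hz
  obtain ⟨hinj, hmem, -⟩ := hz
  ext i j
  simp only [Function.comp_apply, weightsGraph, rankedGraph, SimpleGraph.fromRel_adj, gt_iff_lt]
  refine and_congr_right fun hij => ?_
  rw [signedWeight_add_pos_iff (hmem i).1 (hmem j).1 (hinj.ne hij),
    signedWeight_add_pos_iff (hmem j).1 (hmem i).1 (hinj.ne hij.symm)]
  tauto

end RandomThreshold

end

theorem corollary6p5 (p : unitInterval) (n : ℕ) (hn : 1 ≤ n) :
    RandomThreshold.thresholdSet p = RandomThreshold.quadrilateral p ∧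
    RandomThreshold.permutedSequentialLaw n p =
      RandomThreshold.setGraphLaw n (RandomThreshold.thresholdSet p) ∧
    RandomThreshold.permutedSequentialLaw n p =
      RandomThreshold.weightsGraphLaw n (RandomThreshold.weightLaw p) 0 := by
  exact ⟨RandomThreshold.thresholdSet_eq_quadrilateral p,
    (RandomThreshold.setGraphLaw_thresholdSet n p).symm,
    (RandomThreshold.weightsGraphLaw_weightLaw n p).symm⟩
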